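/- Let $\rho$ be a two-qubit state, i.e. a positive semidefinite operator of trace one on $\mathcal H_A\otimes\mathcal H_B=\mathbb C^2\otimes\mathbb C^2$. For a density matrix $\varrho$ on a $d$-dimensional space let $S^t(\varrho)=-\mathrm{Tr}[\varrho\log_2\varrho+(\mathbb 1-\varrho)\log_2(\mathbb 1-\varrho)]$ (with $0\log_2 0=0$) be its total entropy. For a unit vector $|\Phi\rangle\in\mathcal H_A\otimes\mathcal H_B$ with reduced state $\varrho_A=\mathrm{Tr}_B|\Phi\rangle\langle\Phi|$ put $$E_t(|\Phi\rangle)=\frac1r S^t(\varrho_A),\qquad r=d\log_2 d-(d-1)\log_2(d-1),\quad d=\dim\mathcal H_A \ (=2,\text{ so } r=2),\qquad C(|\Phi\rangle)=\sqrt{2(1-\mathrm{Tr}\,\varrho_A^2)},$$ and extend both to mixed states by the convex roof: $$E_t(\rho)=\inf\sum_i p_iE_t(|\Phi_i\rangle),\qquad C(\rho)=\inf\sum_i p_iC(|\Phi_i\rangle),$$ the infima being over all finite decompositions $\rho=\sum_i p_i|\Phi_i\rangle\langle\Phi_i|$ with unit vectors $|\Phi_i\rangle$, $p_i\ge 0$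 and $\sum_i p_i=1$. Then $$E_t(\rho)=h(C(\rho)),\qquad h(x)=-\tfrac{1+\sqrt{1-x^2}}2\log_2\tfrac{1+\sqrt{1-x^2}}2-\tfrac{1-\sqrt{1-x^2}}2\log_2\tfrac{1-\sqrt{1-x^2}}2,$$ and the concurrence $C(\rho)$ is given by Wootters' formula $C(\rho)=\max\{0,\lambda_1-\lambda_2-\lambda_3-\lambda_4\}$, where $\lambda_1\ge\lambda_2\ge\lambda_3\ge\lambda_4$ are the eigenvalues (with multiplicity) of $\sqrt{\rho(\sigma_Y\otimes\sigma_Y)\rho^*(\sigma_Y\otimes\sigma_Y)}$, that is, the square roots of the eigenvalues of $\rho(\sigma_Y\otimes\sigma_Y)\rho^*(\sigma_Y\otimes\sigma_Y)$, with $\rho^*$ the entrywise complex conjugate in the computational basis and $\sigma_Y$ the Pauli matrix. -/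

import Mathlib

namespace TotalEntropy

open scoped ComplexOrder

/-- `ρ` is a density matrix (a mixed state, possibly pure): positive semidefinite of trace one. -/
def IsState {ι : Type*} [Fintype ι] (ρ : Matrix ι ι ℂ) : Prop :=
  ρ.PosSemidef ∧ ρ.trace = 1

/-- The matrix `|ψ⟩⟨ψ|` of a vector `ψ`. -/
def ketBra {ι : Type*} (ψ : EuclideanSpace ℂ ι) : Matrix ι ι ℂ :=
  Matrix.of fun i j => ψ i * star (ψ j)

/-- The partial trace over the second subsystem. -/
def partialTraceB {A B : Type*} [Fintype B] (ρ : Matrix (A × B) (A × B) ℂ) : Matrix A A ℂ :=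
  Matrix.of fun i j => ∑ k, ρ (i, k) (j, k)

/-- The total entropy `S^t(ρ) = -Tr[ρ log₂ ρ + (1 - ρ) log₂ (1 - ρ)]`. The matrix logarithms are
given by the functional calculus; the convention `Real.logb 2 0 = 0` implements `0 log₂ 0 = 0`. -/
noncomputable def totalEntropy {ι : Type*} [Fintype ι] [DecidableEq ι] (ρ : Matrix ι ι ℂ) : ℝ :=
  -(Matrix.trace (ρ * cfc (Real.logb 2) ρ + (1 - ρ) * cfc (Real.logb 2) (1 - ρ))).re

/-- The normalization factor `r = d log₂ d - (d - 1) log₂ (d - 1)`. -/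
noncomputable def normFactor (d : ℕ) : ℝ :=
  (d : ℝ) * Real.logb 2 d - ((d : ℝ) - 1) * Real.logb 2 ((d : ℝ) - 1)

/-- A decomposition `ρ = ∑ pᵢ |Φᵢ⟩⟨Φᵢ|` of `ρ` into finitely many pure states (unit vectors). -/
structure PureDecomposition {ι : Type*} [Fintype ι] (ρ : Matrix ι ι ℂ) where
  n : ℕ
  p : Fin n → ℝ
  state : Fin n → EuclideanSpace ℂ ι
  p_nonneg : ∀ i, 0 ≤ p i
  p_sum : ∑ i, p i = 1
  state_norm : ∀ i, ‖state i‖ = 1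
  decomp : ρ = ∑ i, (p i : ℂ) • ketBra (state i)

/-- The convex-roof extension of a function `f` of pure states: the infimum of `∑ pᵢ f(Φᵢ)` over
all decompositions of `ρ` into pure states. -/
noncomputable def convexRoof {ι : Type*} [Fintype ι] (f : EuclideanSpace ℂ ι → ℝ)
    (ρ : Matrix ι ι ℂ) : ℝ :=
  ⨅ D : PureDecomposition ρ, ∑ i, D.p i * f (D.state i)

section Bipartite

variable {A B : Type*} [Fintype A] [DecidableEq A] [Fintype B]

/-- The `S^t`-entropy entanglement of a pure state: `S^t(ϱ_A) / r`, where `d = dim H_A`. -/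
noncomputable def pureEntanglement (ψ : EuclideanSpace ℂ (A × B)) : ℝ :=
  1 / normFactor (Fintype.card A) * totalEntropy (partialTraceB (ketBra ψ))

/-- The `S^t`-entropy entanglement `E_t` of a mixed state. -/
noncomputable def entanglement (ρ : Matrix (A × B) (A × B) ℂ) : ℝ :=
  convexRoof pureEntanglement ρ

/-- The concurrence of a pure state: `√(2 (1 - Tr ϱ_A²))`. -/
noncomputable def pureConcurrence (ψ : EuclideanSpace ℂ (A × B)) : ℝ :=
  Real.sqrt (2 * (1 - (Matrix.trace (partialTraceB (ketBra ψ) ^ 2)).re))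

/-- The concurrence of a mixed state, as a convex roof. -/
noncomputable def concurrence (ρ : Matrix (A × B) (A × B) ℂ) : ℝ :=
  convexRoof pureConcurrence ρ

end Bipartite

/-- The Pauli matrix `σ_Y`. -/
def pauliY : Matrix (Fin 2) (Fin 2) ℂ := !![0, -Complex.I; Complex.I, 0]

/-- The matrix `ρ (σ_Y ⊗ σ_Y) ρ* (σ_Y ⊗ σ_Y)`, with `ρ*` the entrywise complex conjugate. -/
noncomputable def spinFlipProduct (ρ : Matrix (Fin 2 × Fin 2) (Fin 2 × Fin 2) ℂ) :
    Matrix (Fin 2 × Fin 2) (Fin 2 × Fin 2) ℂ :=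
  ρ * Matrix.kronecker pauliY pauliY * ρ.map star * Matrix.kronecker pauliY pauliY

/-- The eigenvalues of `√(ρ (σ_Y ⊗ σ_Y) ρ* (σ_Y ⊗ σ_Y))` in decreasing order, with multiplicity.
For a state `ρ` the matrix under the root is a product of two positive semidefinite matrices, so
its eigenvalues are real and nonnegative, and those of its root are their square roots. -/
noncomputable def woottersValues (ρ : Matrix (Fin 2 × Fin 2) (Fin 2 × Fin 2) ℂ) : List ℝ :=
  ((spinFlipProduct ρ).charpoly.roots.map fun z => Real.sqrt z.re).sort (· ≥ ·)

/-- Wootters' expression `max {0, λ₁ - λ₂ - λ₃ - λ₄}`. -/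
noncomputable def woottersConcurrence (ρ : Matrix (Fin 2 × Fin 2) (Fin 2 × Fin 2) ℂ) : ℝ :=
  max 0 ((woottersValues ρ).getD 0 0 - (woottersValues ρ).getD 1 0
    - (woottersValues ρ).getD 2 0 - (woottersValues ρ).getD 3 0)

/-- The function `h(x)`: the binary entropy (base 2) of `(1 + √(1 - x²)) / 2`. -/
noncomputable def h (x : ℝ) : ℝ :=
  -((1 + Real.sqrt (1 - x ^ 2)) / 2 * Real.logb 2 ((1 + Real.sqrt (1 - x ^ 2)) / 2))
    - (1 - Real.sqrt (1 - x ^ 2)) / 2 * Real.logb 2 ((1 - Real.sqrt (1 - x ^ 2)) / 2)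

end TotalEntropy

/-! The spin flip gives a complex bilinear `overlap` of a vector with itself, whose modulus is the
concurrence of a unit vector. For one qubit with eigenvalues `a` and `1 - a` the total entropy is
twice the binary entropy, and `r = 2` cancels the factor, so `E_t = h(C)` on pure states
(`pureEntanglement_eq_h`).

Write `ρ = V Vᴴ`. Replacing `V` by `V U` with `U` unitary gives another decomposition and changes
the symmetric matrix `τ = Vᵀ S V` of overlaps to `Uᵀ τ U`. Takagi factorization makes `τ = diag(l)`
with `l ≥ 0`, and the `l i` are Wootters' values (`woottersValues_eq_ofFn`).

Lower bound (`sub_le_sum_norm_of_mul_conjTranspose_eq`): any decomposition is `w = V c`, its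
overlaps are `∑ i, l i * c i j ^ 2`, and the reverse triangle inequality summed over `j` gives `l 0
- l 1 - l 2 - l 3`.

Attainment (`exists_overlap_eq_zero`, `exists_overlap_eq_mul`): phases followed by a real orthogonal
rotation give all members of positive weight the same concurrence, equal to Wootters' value. Since
`h` is increasing and convex on `[0, 1]`, this one decomposition minimizes both convex roofs. -/

namespace TotalEntropy

open scoped ComplexOrder

open Matrix

/-! ### Takagi factorization via antilinear maps. -/

section Takagi

variable {E : Type*} [NormedAddCommGroup E] [InnerProductSpace ℂ E] [FiniteDimensional ℂ E]

/-- A symmetric antilinear map has a unit coneigenvector with nonnegative coneigenvalue. -/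
theorem exists_unit_coneigenvector [Nontrivial E] (T : E →ₗ⋆[ℂ] E)
    (hT : ∀ x y, inner ℂ x (T y) = inner ℂ y (T x)) :
    ∃ x : E, ‖x‖ = 1 ∧ ∃ s : ℝ, 0 ≤ s ∧ T x = (s : ℂ) • x := by
  suffices H : ∃ x : E, x ≠ 0 ∧ ∃ s : ℝ, 0 ≤ s ∧ T x = (s : ℂ) • x by
    obtain ⟨x, hx, s, hs, h⟩ := H
    have hx' : ‖x‖ ≠ 0 := norm_ne_zero_iff.2 hx
    refine ⟨((‖x‖⁻¹ : ℝ) : ℂ) • x, ?_, s, hs, ?_⟩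
    · rw [norm_smul, Complex.norm_real, norm_inv, norm_norm, inv_mul_cancel₀ hx']
    · rw [LinearMap.map_smulₛₗ, h, Complex.conj_ofReal, smul_comm]
  -- For the real inner product `Re ⟪x, y⟫` the antilinear `T` becomes a real-linear symmetric
  -- operator, so the real spectral theorem provides a real eigenvalue.
  let : InnerProductSpace ℝ E := InnerProductSpace.rclikeToReal ℂ E
  let R : E →ₗ[ℝ] E :=
    { toFun := T
      map_add' := T.map_add
      map_smul' := fun r x => by
        have := T.map_smulₛₗ (r : ℂ) x
        rw [Complex.conj_ofReal] at this
        simpa using this }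
  have hR : LinearMap.IsSymmetric (𝕜 := ℝ) (E := E) R := fun x y => by
    change (inner ℂ (T x) y).re = (inner ℂ x (T y)).re
    rw [hT x y, ← inner_conj_symm, Complex.conj_re]
  obtain ⟨m, x, hx0, hx1⟩ : ∃ (m : ℝ) (x : E), x ≠ 0 ∧ T x = (m : ℂ) • x := by
    obtain ⟨x, hx⟩ := hR.hasEigenvalue_iSup_of_finiteDimensional.exists_hasEigenvector
    exact ⟨_, x, hx.2, hx.apply_eq_smul.trans (RCLike.real_smul_eq_coe_smul (K := ℂ) _ x)⟩
  rcases le_total 0 m with h0 | h0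
  · exact ⟨x, hx0, m, h0, hx1⟩
  -- Antilinearity gives `T (i x) = -i T x`, so multiplying by `i` flips the sign of the
  -- coneigenvalue.
  · refine ⟨Complex.I • x, smul_ne_zero Complex.I_ne_zero hx0, -m, by linarith, ?_⟩
    rw [LinearMap.map_smulₛₗ, hx1, Complex.conj_I, smul_smul, smul_smul]
    congr 1
    push_cast
    ring

/-- Takagi factorization: a symmetric antilinear map is diagonal with nonnegative entries in a
suitable orthonormal basis. -/
theorem exists_orthonormalBasis_coneigenvectors {n : ℕ} (hn : Module.finrank ℂ E = n)
    (T : E →ₗ⋆[ℂ] E) (hT : ∀ x y, inner ℂ x (T y) = inner ℂ y (T x)) :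
    ∃ (b : OrthonormalBasis (Fin n) ℂ E) (s : Fin n → ℝ),
      (∀ i, 0 ≤ s i) ∧ ∀ i, T (b i) = (s i : ℂ) • b i := by
  induction n generalizing E with
  | zero =>
    exact ⟨(stdOrthonormalBasis ℂ E).reindex (finCongr hn), 0, fun i => i.elim0, fun i => i.elim0⟩
  | succ n ih =>
    have : Nontrivial E := Module.nontrivial_of_finrank_pos (R := ℂ) (by omega)
    obtain ⟨x, hx, s, hs, hTx⟩ := exists_unit_coneigenvector T hT
    have hx0 : x ≠ 0 := by
      rintro rfl
      simp at hx
    let K : Submodule ℂ E := (ℂ ∙ x)ᗮ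
    have hK : ∀ y ∈ K, T y ∈ K := fun y hy => by
      rw [Submodule.mem_orthogonal_singleton_iff_inner_right] at hy ⊢
      rw [hT, hTx, inner_smul_right, ← inner_conj_symm, hy]
      simp
    let TK : K →ₗ⋆[ℂ] K :=
      { toFun := fun y => ⟨T y, hK y y.2⟩
        map_add' := fun y z => Subtype.ext (by simp)
        map_smul' := fun c y => Subtype.ext (by simp [LinearMap.map_smulₛₗ]) }
    have hfin : Module.finrank ℂ K = n := by
      have : Fact (Module.finrank ℂ E = n + 1) := ⟨hn⟩
      exact Submodule.finrank_orthogonal_span_singleton hx0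
    obtain ⟨b, t, ht, hb⟩ := ih hfin TK (fun y z => hT y z)
    have hb' : ∀ i, T (b i) = (t i : ℂ) • (b i : E) := fun i => congrArg Subtype.val (hb i)
    have hxb : ∀ i, inner ℂ x (b i : E) = 0 := fun i =>
      Submodule.mem_orthogonal_singleton_iff_inner_right.1 (b i).2
    have hon : Orthonormal ℂ (Fin.cons x (fun i => (b i : E)) : Fin (n + 1) → E) := by
      rw [orthonormal_iff_ite]
      have hbb := orthonormal_iff_ite.1 b.orthonormal
      intro i j
      refine Fin.cases ?_ (fun i => ?_) i <;> refine Fin.cases ?_ (fun j => ?_) j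
      · simp [hx]
      · simp [(Fin.succ_ne_zero j).symm, hxb j]
      · rw [← inner_conj_symm]
        simp [(Fin.succ_ne_zero i), hxb i]
      · simpa using hbb i j
    have hcard : Fintype.card (Fin (n + 1)) = Module.finrank ℂ E := by simp [hn]
    let b' := basisOfOrthonormalOfCardEqFinrank hon hcard
    have hb'' : ⇑b' = Fin.cons x (fun i => (b i : E)) :=
      coe_basisOfOrthonormalOfCardEqFinrank hon hcard
    refine ⟨b'.toOrthonormalBasis (by rw [hb'']; exact hon), Fin.cons s t, ?_, ?_⟩
    · intro i
      refine Fin.cases ?_ (fun i => ?_) i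
      · simpa using hs
      · simpa using ht i
    · intro i
      rw [Module.Basis.coe_toOrthonormalBasis, hb'']
      refine Fin.cases ?_ (fun i => ?_) i
      · simpa using hTx
      · simpa using hb' i

/-- Takagi factorization of a complex symmetric matrix. -/
theorem exists_unitary_takagi {n : ℕ} (M : Matrix (Fin n) (Fin n) ℂ) (hM : Mᵀ = M) :
    ∃ (U : Matrix (Fin n) (Fin n) ℂ) (s : Fin n → ℝ), U * Uᴴ = 1 ∧ (∀ i, 0 ≤ s i) ∧
      Uᵀ * M * U = diagonal fun i => (s i : ℂ) := by
  -- With `T x` the conjugate of `M x`, `⟪x, T y⟫` is the conjugate of `xᵀ M y`, so symmetry of `M`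
  -- is symmetry of `T`. The coneigenvectors become the columns of `U`.
  let T : EuclideanSpace ℂ (Fin n) →ₗ⋆[ℂ] EuclideanSpace ℂ (Fin n) :=
    { toFun := fun x => WithLp.toLp 2 (star (M *ᵥ x.ofLp))
      map_add' := fun x y => by
        ext i
        simp [Matrix.mulVec_add]
      map_smul' := fun c x => by
        ext i
        simp [Matrix.mulVec_smul] }
  have hin : ∀ x y : EuclideanSpace ℂ (Fin n),
      inner ℂ x (T y) = star (x.ofLp ⬝ᵥ M *ᵥ y.ofLp) := fun x y => by
    rw [EuclideanSpace.inner_eq_star_dotProduct, ← Matrix.star_dotProduct_star]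
    rfl
  have hT : ∀ x y, inner ℂ x (T y) = inner ℂ y (T x) := fun x y => by
    rw [hin, hin, Matrix.dotProduct_mulVec, ← Matrix.mulVec_transpose, hM, dotProduct_comm]
  obtain ⟨b, s, hs, hb⟩ := exists_orthonormalBasis_coneigenvectors
    (finrank_euclideanSpace_fin (n := n)) T hT
  let U : Matrix (Fin n) (Fin n) ℂ := Matrix.of fun i k => b k i
  have hbb := orthonormal_iff_ite.1 b.orthonormal
  refine ⟨U, s, mul_eq_one_comm.1 ?_, hs, ?_⟩
  · ext i j
    rw [Matrix.one_apply, ← hbb i j, EuclideanSpace.inner_eq_star_dotProduct]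
    simp [U, Matrix.mul_apply, dotProduct, mul_comm]
  · ext i j
    have h1 : (Uᵀ * M * U) i j = (b i).ofLp ⬝ᵥ M *ᵥ (b j).ofLp := by
      rw [Matrix.mul_assoc, Matrix.mul_apply]
      rfl
    have h2 := hin (b i) (b j)
    rw [hb, inner_smul_right, hbb] at h2
    rw [h1, ← star_star (_ ⬝ᵥ _), ← h2, Matrix.diagonal_apply]
    by_cases h : i = j
    · subst h
      simp
    · simp [h]

end Takagi

end TotalEntropy

/-! ### Monotonicity and convexity of `h`. -/

namespace TotalEntropy

open Real Set

/-- `h` is the binary entropy (base 2) of `(1 + √(1 - x²)) / 2`. -/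
theorem h_eq_binEntropy (x : ℝ) :
    h x = binEntropy ((1 + √(1 - x ^ 2)) / 2) / Real.log 2 := by
  rw [h, binEntropy_eq_negMulLog_add_negMulLog_one_sub, negMulLog, negMulLog,
    show 1 - (1 + √(1 - x ^ 2)) / 2 = (1 - √(1 - x ^ 2)) / 2 by ring]
  simp only [Real.logb]
  ring

theorem continuous_h : Continuous h := by
  rw [funext h_eq_binEntropy]
  exact (binEntropy_continuous.comp (by fun_prop)).div_const _

theorem sqrt_one_sub_sq_mem {x : ℝ} (hx : x ∈ Ioo (0 : ℝ) 1) : √(1 - x ^ 2) ∈ Ioo (0 : ℝ) 1 := by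
  have h1 : 0 < 1 - x ^ 2 := by nlinarith [hx.1, hx.2]
  refine ⟨sqrt_pos.2 h1, ?_⟩
  rw [sqrt_lt' one_pos]
  nlinarith [hx.1]

theorem hasDerivAt_sqrt_one_sub_sq {x : ℝ} (hx : x ∈ Ioo (0 : ℝ) 1) :
    HasDerivAt (fun x : ℝ => √(1 - x ^ 2)) (-x / √(1 - x ^ 2)) x := by
  have h1 : 1 - x ^ 2 ≠ 0 := by nlinarith [hx.1, hx.2]
  have h2 := (((hasDerivAt_id x).pow 2).const_sub 1).sqrt (by simpa using h1)
  refine h2.congr_deriv ?_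
  simp only [Pi.pow_apply, id]
  field_simp
  norm_num

/-- `log (1 + s) - log (1 - s) ≥ 2 s` on `(0, 1)`. -/
theorem two_mul_le_log_sub_log {s : ℝ} (hs : s ∈ Ioo (0 : ℝ) 1) :
    2 * s ≤ Real.log (1 + s) - Real.log (1 - s) := by
  -- The series is `2 ∑ s ^ (2k+1) / (2k+1)` with nonnegative terms; its first term is the bound.
  have h1 := hasSum_log_sub_log_of_abs_lt_one (x := s) (by rw [abs_lt]; constructor <;> linarith [hs.1, hs.2])
  have h2 := h1.summable.sum_le_tsum (Finset.range 1)
    (fun i _ => by have := hs.1; positivity)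
  rw [h1.tsum_eq] at h2
  simpa using h2

theorem hasDerivAt_h {x : ℝ} (hx : x ∈ Ioo (0 : ℝ) 1) :
    HasDerivAt h (x * (Real.log (1 + √(1 - x ^ 2)) - Real.log (1 - √(1 - x ^ 2))) / √(1 - x ^ 2)
      / (2 * Real.log 2)) x := by
  rw [funext h_eq_binEntropy]
  have hs := sqrt_one_sub_sq_mem hx
  set s := √(1 - x ^ 2) with hsdef
  have h1 := ((hasDerivAt_sqrt_one_sub_sq hx).const_add 1).div_const 2
  have h2 := hasDerivAt_binEntropy (p := (1 + s) / 2) (by linarith [hs.1]) (by linarith [hs.2])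
  have h3 := (h2.comp x h1).div_const (Real.log 2)
  refine h3.congr_deriv ?_
  rw [show 1 - (1 + s) / 2 = (1 - s) / 2 by ring,
    Real.log_div (sub_pos.2 hs.2).ne' two_ne_zero, Real.log_div (by linarith [hs.1]) two_ne_zero,
    ← hsdef]
  have := hs.1.ne'
  have hl : Real.log 2 ≠ 0 := (Real.log_pos one_lt_two).ne'
  field_simp
  ring

/-- Up to the constant `2 log 2` this differentiates `h'`. The numerator is nonnegative by
`two_mul_le_log_sub_log`, which is what makes `h` convex. -/
theorem hasDerivAt_deriv_h_aux {x : ℝ} (hx : x ∈ Ioo (0 : ℝ) 1) :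
    HasDerivAt (fun x : ℝ => x * (Real.log (1 + √(1 - x ^ 2)) - Real.log (1 - √(1 - x ^ 2)))
      / √(1 - x ^ 2))
      ((Real.log (1 + √(1 - x ^ 2)) - Real.log (1 - √(1 - x ^ 2)) - 2 * √(1 - x ^ 2))
        / √(1 - x ^ 2) ^ 3) x := by
  have hs := sqrt_one_sub_sq_mem hx
  have hsq : √(1 - x ^ 2) ^ 2 = 1 - x ^ 2 := Real.sq_sqrt (by nlinarith [hx.1, hx.2])
  have h1 := hasDerivAt_sqrt_one_sub_sq hx
  have h2 := (h1.const_add 1).log (by linarith [hs.1])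
  have h3 := (h1.const_sub 1).log (by linarith [hs.2])
  have h4 := ((hasDerivAt_id x).mul (h2.sub h3)).div h1 hs.1.ne'
  refine h4.congr_deriv ?_
  simp only [Pi.sub_apply, id, Pi.mul_apply]
  set s := √(1 - x ^ 2)
  have a1 : 1 + s ≠ 0 := by linarith [hs.1]
  have a2 : 1 - s ≠ 0 := by linarith [hs.2]
  have a3 := hs.1.ne'
  set L := Real.log (1 + s) - Real.log (1 - s)
  have hx2 : x ^ 2 = (1 + s) * (1 - s) := by linear_combination hsq
  have e : -x / s / (1 + s) - -(-x / s) / (1 - s) = -2 * x / (s * x ^ 2) := by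
    rw [hx2]
    field_simp
    ring
  rw [e]
  have hx0 := hx.1.ne'
  field_simp
  linear_combination L * hsq

theorem monotoneOn_h : MonotoneOn h (Icc 0 1) := by
  refine monotoneOn_of_deriv_nonneg (convex_Icc 0 1) continuous_h.continuousOn ?_ ?_ <;>
    rw [interior_Icc]
  · exact fun x hx => (hasDerivAt_h hx).differentiableAt.differentiableWithinAt
  · intro x hx
    rw [(hasDerivAt_h hx).deriv]
    have hs := sqrt_one_sub_sq_mem hx
    have := two_mul_le_log_sub_log hs
    have hl := Real.log_pos one_lt_two
    have := hs.1
    have := hx.1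
    exact div_nonneg (div_nonneg (mul_nonneg hx.1.le (by linarith)) hs.1.le) (by positivity)

theorem convexOn_h : ConvexOn ℝ (Icc 0 1) h := by
  refine MonotoneOn.convexOn_of_deriv (convex_Icc 0 1) continuous_h.continuousOn ?_ ?_ <;>
    rw [interior_Icc]
  · exact fun x hx => (hasDerivAt_h hx).differentiableAt.differentiableWithinAt
  · have hmono : MonotoneOn (fun x : ℝ => x * (Real.log (1 + √(1 - x ^ 2))
        - Real.log (1 - √(1 - x ^ 2))) / √(1 - x ^ 2)) (Ioo 0 1) := by
      refine monotoneOn_of_deriv_nonneg (convex_Ioo 0 1)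
        (fun x hx => (hasDerivAt_deriv_h_aux hx).continuousAt.continuousWithinAt) ?_ ?_ <;>
        rw [interior_Ioo]
      · exact fun x hx => (hasDerivAt_deriv_h_aux hx).differentiableAt.differentiableWithinAt
      · intro x hx
        rw [(hasDerivAt_deriv_h_aux hx).deriv]
        have hs := sqrt_one_sub_sq_mem hx
        exact div_nonneg (by linarith [two_mul_le_log_sub_log hs]) (pow_nonneg hs.1.le 3)
    intro x hx y hy hxy
    rw [(hasDerivAt_h hx).deriv, (hasDerivAt_h hy).deriv]
    have hl := Real.log_pos one_lt_two
    exact div_le_div_of_nonneg_right (hmono hx hy hxy) (by positivity)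

end TotalEntropy

/-! ### Wootters' values as overlaps, and the lower bound. -/

namespace TotalEntropy

open Matrix

/-- The two-qubit spin flip `σ_Y ⊗ σ_Y`. -/
noncomputable def spinFlip : Matrix (Fin 2 × Fin 2) (Fin 2 × Fin 2) ℂ :=
  Matrix.kronecker pauliY pauliY

theorem spinFlip_transpose : spinFlipᵀ = spinFlip := by
  ext ⟨i, i'⟩ ⟨j, j'⟩
  fin_cases i <;> fin_cases i' <;> fin_cases j <;> fin_cases j' <;>
    simp [spinFlip, pauliY, Matrix.kronecker]

theorem spinFlip_map_star : spinFlip.map star = spinFlip := by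
  ext ⟨i, i'⟩ ⟨j, j'⟩
  fin_cases i <;> fin_cases i' <;> fin_cases j <;> fin_cases j' <;>
    simp [spinFlip, pauliY, Matrix.kronecker]

open scoped MatrixOrder ComplexOrder in
/-- Every two-qubit positive semidefinite matrix is a mixture of four unnormalized pure states whose
spin-flip overlaps form a nonnegative diagonal matrix with decreasing entries. -/
theorem exists_spinFlip_diagonal {ρ : Matrix (Fin 2 × Fin 2) (Fin 2 × Fin 2) ℂ}
    (hρ : ρ.PosSemidef) :
    ∃ (V : Matrix (Fin 2 × Fin 2) (Fin 4) ℂ) (l : Fin 4 → ℝ), V * Vᴴ = ρ ∧ (∀ i, 0 ≤ l i) ∧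
      Antitone l ∧ Vᵀ * spinFlip * V = diagonal fun i => (l i : ℂ) := by
  obtain ⟨B, hB⟩ := CStarAlgebra.nonneg_iff_eq_star_mul_self.1 (nonneg_iff_posSemidef.2 hρ)
  let e : Fin 4 ≃ Fin 2 × Fin 2 := (finProdFinEquiv (m := 2) (n := 2)).symm
  let V₀ : Matrix (Fin 2 × Fin 2) (Fin 4) ℂ := Bᴴ.submatrix id e
  have hV₀ : V₀ * V₀ᴴ = ρ := by
    rw [Matrix.conjTranspose_submatrix, Matrix.submatrix_mul_equiv, hB, Matrix.star_eq_conjTranspose]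
    simp
  obtain ⟨U, s, hU, hs, hd⟩ := exists_unitary_takagi (V₀ᵀ * spinFlip * V₀) (by
    rw [Matrix.transpose_mul, Matrix.transpose_mul, spinFlip_transpose, Matrix.transpose_transpose,
      Matrix.mul_assoc])
  -- Sorting the negatives increasingly puts the `s i` in decreasing order.
  let p : Equiv.Perm (Fin 4) := Tuple.sort fun i => -s i
  have hp : Monotone ((fun i => -s i) ∘ p) := Tuple.monotone_sort _
  refine ⟨(V₀ * U).submatrix id p, s ∘ p, ?_, fun i => hs _, fun i j hij => ?_, ?_⟩
  · rw [Matrix.conjTranspose_submatrix, Matrix.submatrix_mul_equiv, Matrix.conjTranspose_mul,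
      Matrix.mul_assoc, ← Matrix.mul_assoc U, hU, Matrix.one_mul, hV₀, Matrix.submatrix_id_id]
  · simpa using hp hij
  · have h1 : (V₀ * U)ᵀ * spinFlip * (V₀ * U) = diagonal fun i => (s i : ℂ) := by
      rw [← hd, Matrix.transpose_mul]
      simp only [Matrix.mul_assoc]
    have h2 : ((V₀ * U).submatrix id p)ᵀ * spinFlip * (V₀ * U).submatrix id p
        = ((V₀ * U)ᵀ * spinFlip * (V₀ * U)).submatrix p p := by
      rw [Matrix.transpose_submatrix, Matrix.submatrix_mul _ _ p id p Function.bijective_id,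
        Matrix.submatrix_mul _ _ p id id Function.bijective_id, Matrix.submatrix_id_id]
    rw [h2, h1, Matrix.submatrix_diagonal_equiv]
    rfl

open Polynomial in
-- The product is `V * B` with `B = Vᴴ S V̄ Vᵀ S`, and `B * V = (Vᴴ S V̄)(Vᵀ S V)` is the square of
-- `diag(l)`. Moving `V` around costs powers of `X` on both sides, each with exponent 4, which
-- cancel.
theorem charpoly_spinFlipProduct {V : Matrix (Fin 2 × Fin 2) (Fin 4) ℂ} {l : Fin 4 → ℝ}
    (hV : Vᵀ * spinFlip * V = diagonal fun i => (l i : ℂ)) :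
    (spinFlipProduct (V * Vᴴ)).charpoly = ∏ i, (X - C ((l i ^ 2 : ℝ) : ℂ)) := by
  have h1 : Vᴴ * spinFlip * V.map star = diagonal fun i => (l i : ℂ) := by
    have h := congrArg (fun M : Matrix (Fin 4) (Fin 4) ℂ => M.map (starRingEnd ℂ)) hV
    simp only [Matrix.map_mul, Matrix.diagonal_map (map_zero (starRingEnd ℂ)),
      Complex.conj_ofReal] at h
    have hs : spinFlip.map (starRingEnd ℂ) = spinFlip := spinFlip_map_star
    rw [hs] at h
    exact h
  have h2 : spinFlipProduct (V * Vᴴ) = V * (Vᴴ * spinFlip * V.map star * Vᵀ * spinFlip) := by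
    have : (V * Vᴴ).map star = V.map star * Vᵀ := by
      have h := Matrix.map_mul (L := V) (M := Vᴴ) (f := starRingEnd ℂ)
      refine h.trans ?_
      congr 1
      ext i j
      simp
    rw [spinFlipProduct, this]
    simp only [Matrix.mul_assoc]
    rfl
  have h3 := Matrix.charpoly_mul_comm' V (Vᴴ * spinFlip * V.map star * Vᵀ * spinFlip)
  rw [← h2, h1, Matrix.mul_assoc, Matrix.mul_assoc, ← Matrix.mul_assoc (Vᵀ), hV,
    Matrix.diagonal_mul_diagonal, Matrix.charpoly_diagonal] at h3
  have h4 := mul_left_cancel₀ (pow_ne_zero _ X_ne_zero) h3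
  rw [h4]
  simp [sq]

theorem woottersValues_eq_ofFn {V : Matrix (Fin 2 × Fin 2) (Fin 4) ℂ} {l : Fin 4 → ℝ}
    (hl : ∀ i, 0 ≤ l i) (hl' : Antitone l)
    (hV : Vᵀ * spinFlip * V = diagonal fun i => (l i : ℂ)) :
    woottersValues (V * Vᴴ) = List.ofFn l := by
  have h1 : (spinFlipProduct (V * Vᴴ)).charpoly.roots
      = Finset.univ.val.map fun i => ((l i ^ 2 : ℝ) : ℂ) := by
    rw [charpoly_spinFlipProduct hV, ← Polynomial.roots_multiset_prod_X_sub_C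
      (Finset.univ.val.map fun i => ((l i ^ 2 : ℝ) : ℂ)), Multiset.map_map]
    rfl
  have h2 : (Finset.univ.val.map fun i => ((l i ^ 2 : ℝ) : ℂ)).map (fun z => √z.re)
      = (List.ofFn l : Multiset ℝ) := by
    rw [Multiset.map_map, ← Fin.univ_val_map]
    refine Multiset.map_congr rfl fun i _ => ?_
    simp only [Function.comp, Complex.ofReal_re]
    exact Real.sqrt_sq (hl i)
  rw [woottersValues, h1, h2, Multiset.coe_sort]
  exact List.mergeSort_eq_self _ (List.pairwise_ofFn.2 fun i j hij => hl' hij.le)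

theorem woottersConcurrence_eq {V : Matrix (Fin 2 × Fin 2) (Fin 4) ℂ} {l : Fin 4 → ℝ}
    (hl : ∀ i, 0 ≤ l i) (hl' : Antitone l)
    (hV : Vᵀ * spinFlip * V = diagonal fun i => (l i : ℂ)) :
    woottersConcurrence (V * Vᴴ) = max 0 (l 0 - l 1 - l 2 - l 3) := by
  rw [woottersConcurrence, woottersValues_eq_ofFn hl hl' hV]
  simp [List.ofFn_succ]

open scoped ComplexOrder in
/-- Two factorizations of the same positive semidefinite matrix have the same column space. -/
theorem exists_mul_of_mul_conjTranspose_eq {m k n : Type*} [Fintype m] [Fintype k]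
    [Fintype n] {V : Matrix m k ℂ} {w : Matrix m n ℂ} (hw : w * wᴴ = V * Vᴴ) :
    ∃ c : Matrix k n ℂ, w = V * c := by
  classical
  have h1 : (w * wᴴ).mulVecLin.range ≤ w.mulVecLin.range := by
    rw [Matrix.mulVecLin_mul]
    exact LinearMap.range_comp_le_range _ _
  have h2 : (V * Vᴴ).mulVecLin.range ≤ V.mulVecLin.range := by
    rw [Matrix.mulVecLin_mul]
    exact LinearMap.range_comp_le_range _ _
  -- `w * wᴴ` and `w` have equal rank, so their nested ranges coincide. No invertibility is needed,
  -- so `ρ` may be singular.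
  have h3 := Submodule.eq_of_le_of_finrank_eq h1 (Matrix.rank_self_mul_conjTranspose w)
  rw [hw] at h3
  have h4 : ∀ j, ∃ c : k → ℂ, V *ᵥ c = w.col j := fun j => by
    have : w.col j ∈ w.mulVecLin.range := ⟨Pi.single j 1, by simp⟩
    rw [← h3] at this
    exact h2 this
  choose c hc using h4
  refine ⟨Matrix.of fun i j => c j i, ?_⟩
  ext i j
  exact (congrFun (hc j) i).symm

/-- The average overlap of any decomposition is bounded below by Wootters' expression. -/
theorem sub_le_sum_norm_of_mul_conjTranspose_eq {n : Type*} [Fintype n]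
    {V : Matrix (Fin 2 × Fin 2) (Fin 4) ℂ} {l : Fin 4 → ℝ} (hl : ∀ i, 0 ≤ l i)
    (hV : Vᵀ * spinFlip * V = diagonal fun i => (l i : ℂ))
    {w : Matrix (Fin 2 × Fin 2) n ℂ} (hw : w * wᴴ = V * Vᴴ) :
    l 0 - l 1 - l 2 - l 3 ≤ ∑ j, ‖(wᵀ * spinFlip * w) j j‖ := by
  obtain ⟨c, rfl⟩ := exists_mul_of_mul_conjTranspose_eq hw
  -- For singular `ρ` the rows of `c` need not be unit vectors. Multiplying `w wᴴ = V Vᴴ` by `Vᵀ S`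
  -- on the left and its adjoint on the right shows that row `i` is one whenever `l i ≠ 0`; the
  -- other rows carry weight zero.
  have h1 : ∀ i, l i * ∑ j, ‖c i j‖ ^ 2 = l i := fun i => by
    have h2 : (Vᵀ * spinFlip * (V * c)) * (Vᵀ * spinFlip * (V * c))ᴴ
        = (Vᵀ * spinFlip * V) * (Vᵀ * spinFlip * V)ᴴ := by
      have : ∀ (A : Matrix (Fin 4) (Fin 2 × Fin 2) ℂ), (A * (V * c)) * (A * (V * c))ᴴ
          = (A * V) * (A * V)ᴴ := fun A => by
        rw [Matrix.conjTranspose_mul, Matrix.conjTranspose_mul A V, Matrix.mul_assoc,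
          ← Matrix.mul_assoc (V * c), hw]
        simp only [Matrix.mul_assoc]
      exact this _
    rw [← Matrix.mul_assoc _ V c, hV] at h2
    have h3 := congrFun (congrFun h2 i) i
    rw [Matrix.mul_apply, Matrix.diagonal_conjTranspose, Matrix.diagonal_mul_diagonal,
      Matrix.diagonal_apply_eq] at h3
    simp only [Matrix.diagonal_mul, Matrix.conjTranspose_apply, Pi.star_apply] at h3
    have h4 : ((l i ^ 2 * ∑ j, ‖c i j‖ ^ 2 : ℝ) : ℂ) = ((l i ^ 2 : ℝ) : ℂ) := by
      push_cast
      rw [Finset.mul_sum]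
      simp only [star_mul', RCLike.star_def, Complex.conj_ofReal] at h3
      rw [sq (l i : ℂ)]
      refine Eq.trans ?_ h3
      refine Finset.sum_congr rfl fun j _ => ?_
      rw [← Complex.mul_conj']
      ring
    have h5 : l i ^ 2 * ∑ j, ‖c i j‖ ^ 2 = l i ^ 2 := by exact_mod_cast h4
    rcases eq_or_ne (l i) 0 with h0 | h0
    · rw [h0, zero_mul]
    · exact mul_left_cancel₀ h0 (by rw [← mul_assoc, ← sq, h5])
  have h6 : ∀ j, ((V * c)ᵀ * spinFlip * (V * c)) j j = ∑ i, (l i : ℂ) * c i j ^ 2 := fun j => by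
    have : (V * c)ᵀ * spinFlip * (V * c) = cᵀ * ((Vᵀ * spinFlip * V) * c) := by
      rw [Matrix.transpose_mul]
      simp only [Matrix.mul_assoc]
    rw [this, hV, Matrix.mul_apply]
    refine Finset.sum_congr rfl fun i _ => ?_
    rw [Matrix.diagonal_mul, Matrix.transpose_apply]
    ring
  have h7 : ∀ j, l 0 * ‖c 0 j‖ ^ 2 - l 1 * ‖c 1 j‖ ^ 2 - l 2 * ‖c 2 j‖ ^ 2 - l 3 * ‖c 3 j‖ ^ 2
      ≤ ‖((V * c)ᵀ * spinFlip * (V * c)) j j‖ := fun j => by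
    have hn : ∀ i, ‖(l i : ℂ) * c i j ^ 2‖ = l i * ‖c i j‖ ^ 2 := fun i => by
      rw [norm_mul, norm_pow, Complex.norm_real, Real.norm_of_nonneg (hl i)]
    rw [h6, Fin.sum_univ_four, ← hn, ← hn, ← hn, ← hn]
    set a := (l 0 : ℂ) * c 0 j ^ 2
    set b := (l 1 : ℂ) * c 1 j ^ 2
    set d := (l 2 : ℂ) * c 2 j ^ 2
    set e := (l 3 : ℂ) * c 3 j ^ 2
    have e1 := norm_sub_le (a + b + d + e) e
    have e2 := norm_sub_le (a + b + d) d
    have e3 := norm_sub_le (a + b) b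
    rw [add_sub_cancel_right] at e1 e2 e3
    linarith
  refine le_trans (le_of_eq ?_) (Finset.sum_le_sum fun j _ => h7 j)
  simp only [Finset.sum_sub_distrib, ← Finset.mul_sum, h1]

end TotalEntropy

/-! ### Decompositions with equal concurrences. -/

namespace TotalEntropy

open Matrix

/-- The rescaled Hadamard matrix of order four, which is orthogonal. -/
noncomputable def hadamardFour : Matrix (Fin 4) (Fin 4) ℝ :=
  !![1 / 2, 1 / 2, 1 / 2, 1 / 2; 1 / 2, -1 / 2, 1 / 2, -1 / 2;
    1 / 2, 1 / 2, -1 / 2, -1 / 2; 1 / 2, -1 / 2, -1 / 2, 1 / 2]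

theorem hadamardFour_mul_transpose : hadamardFour * hadamardFourᵀ = 1 := by
  ext i j
  fin_cases i <;> fin_cases j <;>
    simp [hadamardFour, Matrix.mul_apply, Fin.sum_univ_four] <;> norm_num

theorem hadamardFour_sq (i j : Fin 4) : hadamardFour i j * hadamardFour i j = 1 / 4 := by
  fin_cases i <;> fin_cases j <;> simp [hadamardFour] <;> norm_num

/-- A traceless real symmetric matrix of order four has zero diagonal in an orthonormal basis. -/
theorem exists_orthogonal_diag_eq_zero {M : Matrix (Fin 4) (Fin 4) ℝ} (hM : M.IsHermitian)
    (htr : M.trace = 0) :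
    ∃ O : Matrix (Fin 4) (Fin 4) ℝ, O * Oᵀ = 1 ∧ ∀ k, (Oᵀ * M * O) k k = 0 := by
  let Q : Matrix (Fin 4) (Fin 4) ℝ := hM.eigenvectorUnitary
  have hQ : Q * Qᵀ = 1 := (Matrix.mem_unitaryGroup_iff).1 hM.eigenvectorUnitary.2
  have hQ' : Qᵀ * Q = 1 := mul_eq_one_comm.1 hQ
  have hsp : M = Q * diagonal hM.eigenvalues * Qᵀ := hM.spectral_theorem
  have hd : Qᵀ * M * Q = diagonal hM.eigenvalues := by
    conv_lhs => rw [hsp]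
    simp only [Matrix.mul_assoc, hQ', Matrix.mul_one]
    rw [← Matrix.mul_assoc, hQ', Matrix.one_mul]
  -- After diagonalization, every squared entry of the Hadamard matrix being `1/4` makes each
  -- diagonal entry the mean of the eigenvalues, which is zero.
  refine ⟨Q * hadamardFour, ?_, fun k => ?_⟩
  · rw [Matrix.transpose_mul, Matrix.mul_assoc, ← Matrix.mul_assoc hadamardFour,
      hadamardFour_mul_transpose, Matrix.one_mul, hQ]
  · have h1 : (Q * hadamardFour)ᵀ * M * (Q * hadamardFour)
        = hadamardFourᵀ * (diagonal hM.eigenvalues * hadamardFour) := by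
      rw [← hd, Matrix.transpose_mul]
      simp only [Matrix.mul_assoc]
    have h2 : ∑ i, hM.eigenvalues i = 0 := by
      rw [← htr, hM.trace_eq_sum_eigenvalues]
      simp
    rw [h1, Matrix.mul_apply]
    have h3 : ∀ i, hadamardFourᵀ k i * (diagonal hM.eigenvalues * hadamardFour) i k
        = hM.eigenvalues i * (1 / 4) := fun i => by
      rw [Matrix.diagonal_mul, Matrix.transpose_apply, ← hadamardFour_sq i k]
      ring
    rw [Finset.sum_congr rfl fun i _ => h3 i, ← Finset.sum_mul, h2, zero_mul]

/-- Two sides of lengths `a` and `b` close up to a triangle with third side `r`. -/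
theorem exists_unit_add_eq {a b r : ℝ} (h1 : |a - b| ≤ r)
    (h2 : r ≤ a + b) :
    ∃ u v : ℂ, ‖u‖ = 1 ∧ ‖v‖ = 1 ∧ (a : ℂ) * u + b * v = r := by
  have hr : 0 ≤ r := (abs_nonneg _).trans h1
  let f : ℝ → ℝ := fun t => ‖(a : ℂ) + b * Complex.exp (t * Complex.I)‖
  have hf : ContinuousOn f (Set.Icc 0 Real.pi) := by
    apply Continuous.continuousOn
    fun_prop
  have hf0 : r ≤ f 0 := by
    simp only [f, Complex.ofReal_zero, zero_mul, Complex.exp_zero, mul_one]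
    rw [← Complex.ofReal_add, Complex.norm_real]
    exact h2.trans (le_abs_self _)
  have hfp : f Real.pi ≤ r := by
    simp only [f, Complex.exp_pi_mul_I]
    rw [mul_neg_one, ← sub_eq_add_neg, ← Complex.ofReal_sub, Complex.norm_real]
    exact h1
  -- As the angle runs from `0` to `π`, the length of `a + b exp(it)` passes from at least `r` to at
  -- most `r`. Rotating the resulting vector makes it equal to `r`.
  obtain ⟨t, -, ht⟩ := intermediate_value_Icc' Real.pi_pos.le hf ⟨hfp, hf0⟩
  set z : ℂ := (a : ℂ) + b * Complex.exp (t * Complex.I) with hz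
  have ht' : ‖z‖ = r := ht
  have hexp : ‖Complex.exp (t * Complex.I)‖ = 1 := Complex.norm_exp_ofReal_mul_I t
  rcases eq_or_ne z 0 with h0 | h0
  · refine ⟨1, Complex.exp (t * Complex.I), norm_one, hexp, ?_⟩
    rw [← ht', h0, mul_one, ← hz, h0]
    simp
  · have hn : ‖z‖ ≠ 0 := norm_ne_zero_iff.2 h0
    have hw : ‖(‖z‖ : ℂ) / z‖ = 1 := by
      rw [norm_div, Complex.norm_real, norm_norm, div_self hn]
    refine ⟨‖z‖ / z, Complex.exp (t * Complex.I) * (‖z‖ / z), hw, ?_, ?_⟩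
    · rw [norm_mul, hexp, hw, one_mul]
    · calc (a : ℂ) * (‖z‖ / z) + b * (Complex.exp (t * Complex.I) * (‖z‖ / z))
          = z * (‖z‖ / z) := by rw [hz]; ring
        _ = r := by rw [mul_div_cancel₀ _ h0, ht']

/-- Four sides, the longest of which is at most the sum of the others, close up to a polygon. -/
theorem exists_unit_sum_eq_zero {l : Fin 4 → ℝ} (hl : ∀ i, 0 ≤ l i) (hl' : Antitone l)
    (h : l 0 ≤ l 1 + l 2 + l 3) :
    ∃ u : Fin 4 → ℂ, (∀ i, ‖u i‖ = 1) ∧ ∑ i, (l i : ℂ) * u i = 0 := by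
  have h01 : l 1 ≤ l 0 := hl' (by decide)
  have h12 : l 2 ≤ l 1 := hl' (by decide)
  have h23 : l 3 ≤ l 2 := hl' (by decide)
  have h3 := hl 3
  have h1 := hl 1
  have m1 := le_max_left (l 0 - l 1) (l 2 - l 3)
  have m2 := le_max_right (l 0 - l 1) (l 2 - l 3)
  -- The maximum is the length of a diagonal cutting the quadrilateral into two triangles: it is the
  -- least length allowed by both pairs of sides, and `h` keeps it below `l 2 + l 3`.
  obtain ⟨u, v, hu, hv, e⟩ := exists_unit_add_eq (a := l 0) (b := l 1)
    (r := max (l 0 - l 1) (l 2 - l 3))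
    (by rwa [abs_of_nonneg (by linarith)]) (max_le (by linarith) (by linarith))
  obtain ⟨u', v', hu', hv', e'⟩ := exists_unit_add_eq (a := l 2) (b := l 3)
    (r := max (l 0 - l 1) (l 2 - l 3))
    (by rwa [abs_of_nonneg (by linarith)]) (max_le (by linarith) (by linarith))
  refine ⟨![u, v, -u', -v'], fun i => ?_, ?_⟩
  · fin_cases i <;> simp [hu, hv, hu', hv']
  · simp only [Fin.sum_univ_four, Matrix.cons_val]
    linear_combination e - e'

theorem conj_mul_self_of_norm_one {z : ℂ} (hz : ‖z‖ = 1) : z * star z = 1 := by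
  rw [RCLike.star_def, Complex.mul_conj', hz]
  simp

theorem mul_conjTranspose_mul_unitary {m n : Type*} [Fintype n] [DecidableEq n]
    (V : Matrix m n ℂ) {U : Matrix n n ℂ} (hU : U * Uᴴ = 1) : V * U * (V * U)ᴴ = V * Vᴴ := by
  rw [Matrix.conjTranspose_mul, Matrix.mul_assoc, ← Matrix.mul_assoc U, hU, Matrix.one_mul]

theorem map_ofReal_mul_conjTranspose {n : Type*} [Fintype n] [DecidableEq n]
    {O : Matrix n n ℝ} (hO : O * Oᵀ = 1) :
    O.map Complex.ofReal * (O.map Complex.ofReal)ᴴ = 1 := by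
  have h := congrArg (fun M : Matrix n n ℝ => M.map Complex.ofRealHom) hO
  simp only [Matrix.map_mul] at h
  rw [Matrix.map_one _ (map_zero _) (map_one _)] at h
  rw [← h]
  congr 1
  ext i j
  simp

theorem diagonal_mul_conjTranspose_of_norm_one {n : Type*} [Fintype n] [DecidableEq n]
    {c : n → ℂ} (hc : ∀ i, ‖c i‖ = 1) : diagonal c * (diagonal c)ᴴ = 1 := by
  rw [Matrix.diagonal_conjTranspose, Matrix.diagonal_mul_diagonal, ← Matrix.diagonal_one]
  exact congrArg _ (funext fun i => conj_mul_self_of_norm_one (hc i))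

/-- There is a decomposition all of whose members have overlap zero. -/
theorem exists_overlap_eq_zero {V : Matrix (Fin 2 × Fin 2) (Fin 4) ℂ} {l : Fin 4 → ℝ}
    (hl : ∀ i, 0 ≤ l i) (hl' : Antitone l)
    (hV : Vᵀ * spinFlip * V = diagonal fun i => (l i : ℂ))
    (h : l 0 ≤ l 1 + l 2 + l 3) :
    ∃ w : Matrix (Fin 2 × Fin 2) (Fin 4) ℂ, w * wᴴ = V * Vᴴ ∧
      ∀ k, (wᵀ * spinFlip * w) k k = 0 := by
  obtain ⟨u, hu, hsum⟩ := exists_unit_sum_eq_zero hl hl' h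
  -- Overlaps are quadratic, so the phases applied to the columns are square roots of the `u i`.
  choose c hc using fun i => IsAlgClosed.exists_pow_nat_eq (u i) two_pos
  have hc1 : ∀ i, ‖c i‖ = 1 := fun i => by
    have := hu i
    rw [← hc i, norm_pow] at this
    exact (pow_eq_one_iff_of_nonneg (norm_nonneg _) two_ne_zero).1 this
  refine ⟨V * diagonal c * hadamardFour.map Complex.ofReal, ?_, fun k => ?_⟩
  · rw [mul_conjTranspose_mul_unitary _ (map_ofReal_mul_conjTranspose hadamardFour_mul_transpose),
      mul_conjTranspose_mul_unitary _ (diagonal_mul_conjTranspose_of_norm_one hc1)]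
  · set H := hadamardFour.map Complex.ofReal
    have h1 : (V * diagonal c * H)ᵀ * spinFlip * (V * diagonal c * H)
        = Hᵀ * (diagonal c * ((Vᵀ * spinFlip * V) * (diagonal c * H))) := by
      rw [Matrix.transpose_mul, Matrix.transpose_mul, Matrix.diagonal_transpose]
      simp only [Matrix.mul_assoc]
    rw [h1, hV, Matrix.mul_apply]
    have h2 : ∀ i, Hᵀ k i * (diagonal c * ((diagonal fun i => (l i : ℂ)) * (diagonal c * H))) i k
        = l i * u i * (1 / 4) := fun i => by
      have h3 : H i k * H i k = 1 / 4 := by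
        have := congrArg Complex.ofReal (hadamardFour_sq i k)
        simpa [H] using this
      rw [Matrix.diagonal_mul, Matrix.diagonal_mul, Matrix.diagonal_mul, Matrix.transpose_apply,
        ← h3, ← hc]
      ring
    rw [Finset.sum_congr rfl fun i _ => h2 i, ← Finset.sum_mul, hsum, zero_mul]

/-- There is a decomposition all of whose members have the same overlap per unit weight. -/
theorem exists_overlap_eq_mul {V : Matrix (Fin 2 × Fin 2) (Fin 4) ℂ} {l : Fin 4 → ℝ}
    (hV : Vᵀ * spinFlip * V = diagonal fun i => (l i : ℂ)) (htr : (V * Vᴴ).trace = 1) :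
    ∃ w : Matrix (Fin 2 × Fin 2) (Fin 4) ℂ, w * wᴴ = V * Vᴴ ∧
      ∀ k, (wᵀ * spinFlip * w) k k = ((l 0 - l 1 - l 2 - l 3 : ℝ) : ℂ) * (wᴴ * w) k k := by
  set W : ℝ := l 0 - l 1 - l 2 - l 3 with hW
  -- The factors `i` change the diagonal to `l 0, -l 1, -l 2, -l 3`, whose trace is `W`.
  let c : Fin 4 → ℂ := ![1, Complex.I, Complex.I, Complex.I]
  let d : Fin 4 → ℝ := ![l 0, -l 1, -l 2, -l 3]
  have hc1 : ∀ i, ‖c i‖ = 1 := fun i => by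
    fin_cases i <;> simp [c]
  have hcd : ∀ i, c i * ((l i : ℂ) * c i) = d i := fun i => by
    rw [mul_left_comm]
    fin_cases i <;> simp [c, d]
  let V₁ := V * diagonal c
  have hV₁ : V₁ * V₁ᴴ = V * Vᴴ :=
    mul_conjTranspose_mul_unitary _ (diagonal_mul_conjTranspose_of_norm_one hc1)
  have hτ : V₁ᵀ * spinFlip * V₁ = diagonal fun i => (d i : ℂ) := by
    have h1 : V₁ᵀ * spinFlip * V₁ = diagonal c * ((Vᵀ * spinFlip * V) * diagonal c) := by
      rw [Matrix.transpose_mul, Matrix.diagonal_transpose]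
      simp only [V₁, Matrix.mul_assoc]
    rw [h1, hV, Matrix.diagonal_mul_diagonal, Matrix.diagonal_mul_diagonal]
    exact congrArg _ (funext hcd)
  let G : Matrix (Fin 4) (Fin 4) ℂ := V₁ᴴ * V₁
  have hG : G.IsHermitian := Matrix.isHermitian_conjTranspose_mul_self V₁
  -- The diagonal of `M` measures the defect of "overlap = `W` times weight". Its trace is `W - W =
  -- 0`, so an orthogonal rotation can make every defect vanish. A real rotation has `Pᴴ = Pᵀ`,
  -- hence acts alike on overlaps and on the Gram matrix `G`, whose antisymmetric imaginary part
  -- never reaches the diagonal.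
  let M : Matrix (Fin 4) (Fin 4) ℝ := diagonal d - W • G.map Complex.re
  have hM : M.IsHermitian := by
    ext i j
    have h1 : (G j i).re = (G i j).re := by
      rw [← hG.apply i j, RCLike.star_def, Complex.conj_re]
    simp only [M, Matrix.conjTranspose_apply, Matrix.sub_apply, Matrix.smul_apply, Matrix.map_apply,
      star_trivial, h1, Matrix.diagonal_apply]
    by_cases h : i = j
    · subst h
      rfl
    · simp [h, Ne.symm h]
  have hMtr : M.trace = 0 := by
    have h1 : G.trace = 1 := by
      rw [Matrix.trace_mul_comm, hV₁, htr]
    have h2 : (G.map Complex.re).trace = 1 := by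
      have := congrArg Complex.re h1
      simpa [Matrix.trace] using this
    rw [Matrix.trace_sub, Matrix.trace_smul, h2, Matrix.trace_diagonal, Fin.sum_univ_four]
    simp only [d, Matrix.cons_val, hW, smul_eq_mul]
    ring
  obtain ⟨O, hO, hdiag⟩ := exists_orthogonal_diag_eq_zero hM hMtr
  refine ⟨V₁ * O.map Complex.ofReal, ?_, fun k => ?_⟩
  · rw [mul_conjTranspose_mul_unitary _ (map_ofReal_mul_conjTranspose hO), hV₁]
  · set P := O.map Complex.ofReal
    have hP : Pᴴ = Pᵀ := by
      ext i j
      simp [P]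
    have h1 : (V₁ * P)ᵀ * spinFlip * (V₁ * P) = Pᵀ * (V₁ᵀ * spinFlip * V₁) * P := by
      rw [Matrix.transpose_mul]
      simp only [Matrix.mul_assoc]
    have h2 : (V₁ * P)ᴴ * (V₁ * P) = Pᵀ * G * P := by
      rw [Matrix.conjTranspose_mul, hP]
      simp only [G, Matrix.mul_assoc]
    have hGk : (Pᵀ * G * P) k k = ((Oᵀ * G.map Complex.re * O) k k : ℝ) := by
      have h3 : ((Pᵀ * G * P) k k).im = 0 := by
        have := (Matrix.isHermitian_conjTranspose_mul_self (V₁ * P)).apply k k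
        rw [h2] at this
        exact Complex.conj_eq_iff_im.1 this
      refine Complex.ext ?_ (by rw [h3, Complex.ofReal_im])
      simp [P, Matrix.mul_apply, Matrix.transpose_apply]
    have hDk : (Pᵀ * (diagonal fun i => (d i : ℂ)) * P) k k = ((Oᵀ * diagonal d * O) k k : ℝ) := by
      simp [P, Matrix.mul_apply, Matrix.diagonal_apply, apply_ite]
    have h4 := hdiag k
    simp only [M, Matrix.mul_sub, Matrix.sub_mul, Matrix.mul_smul, Matrix.smul_mul,
      Matrix.sub_apply, Matrix.smul_apply, smul_eq_mul] at h4
    rw [h1, hτ, h2, hDk, hGk, sub_eq_zero.1 h4, Complex.ofReal_mul]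

end TotalEntropy

/-! ### Total entropy and concurrence of pure states. -/

namespace TotalEntropy

open Matrix

open scoped ComplexOrder

theorem trace_cfc {ι : Type*} [Fintype ι] [DecidableEq ι] {R : Matrix ι ι ℂ} (hR : R.IsHermitian)
    (f : ℝ → ℝ) : (cfc f R).trace = ((∑ i, f (hR.eigenvalues i) : ℝ) : ℂ) := by
  rw [hR.cfc_eq, Matrix.IsHermitian.cfc, Unitary.conjStarAlgAut_apply, Matrix.trace_mul_cycle,
    Unitary.coe_star_mul_self, Matrix.one_mul, Matrix.trace_diagonal]
  simp

/-- The total entropy of a Hermitian matrix is the sum of the binary entropies of its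
eigenvalues. -/
theorem totalEntropy_eq_sum {ι : Type*} [Fintype ι] [DecidableEq ι] {R : Matrix ι ι ℂ}
    (hR : R.IsHermitian) :
    totalEntropy R = (∑ i, Real.binEntropy (hR.eigenvalues i)) / Real.log 2 := by
  have hR' : IsSelfAdjoint R := hR
  -- The spectrum is finite, so even the logarithm, discontinuous at `0`, is admissible in the
  -- functional calculus.
  have hc : ∀ f : ℝ → ℝ, ContinuousOn f (spectrum ℝ R) :=
    fun f => (Matrix.finite_real_spectrum (A := R)).continuousOn f
  have h1 : R * cfc (Real.logb 2) R = cfc (fun x => x * Real.logb 2 x) R := by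
    rw [cfc_mul _ _ R (hc _) (hc _), cfc_id' ℝ R]
  have h2 : (1 : Matrix ι ι ℂ) - R = cfc (fun x : ℝ => 1 - x) R := by
    rw [cfc_sub _ _ R (hc _) (hc _), cfc_id' ℝ R, cfc_const_one ℝ R]
  have h3 : cfc (Real.logb 2) (1 - R) = cfc (fun x => Real.logb 2 (1 - x)) R := by
    rw [h2, ← cfc_comp' (Real.logb 2) (fun x : ℝ => 1 - x) R
      (((Matrix.finite_real_spectrum (A := R)).image _).continuousOn _) (hc _)]
  have h4 : (1 - R) * cfc (Real.logb 2) (1 - R)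
      = cfc (fun x => (1 - x) * Real.logb 2 (1 - x)) R := by
    rw [h3, cfc_mul _ _ R (hc _) (hc _), ← h2]
  rw [totalEntropy, h1, h4, Matrix.trace_add, trace_cfc hR, trace_cfc hR, ← Complex.ofReal_add,
    Complex.ofReal_re, ← Finset.sum_add_distrib, ← Finset.sum_neg_distrib, Finset.sum_div]
  refine Finset.sum_congr rfl fun i _ => ?_
  rw [Real.binEntropy_eq_negMulLog_add_negMulLog_one_sub, Real.negMulLog, Real.negMulLog]
  simp only [Real.logb]
  ring

/-- The overlap `⟨ψ̃|ψ⟩` of a two-qubit vector with its spin flip (up to conjugation). -/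
noncomputable def overlap (v : Fin 2 × Fin 2 → ℂ) : ℂ :=
  v ⬝ᵥ spinFlip *ᵥ v

theorem overlap_eq (v : Fin 2 × Fin 2 → ℂ) :
    overlap v = 2 * (v (0, 1) * v (1, 0) - v (0, 0) * v (1, 1)) := by
  simp [overlap, dotProduct, Matrix.mulVec, Fintype.sum_prod_type, Fin.sum_univ_two, spinFlip,
    pauliY, Matrix.kronecker]
  ring

theorem overlap_smul (c : ℂ) (v : Fin 2 × Fin 2 → ℂ) : overlap (c • v) = c ^ 2 * overlap v := by
  simp only [overlap_eq, Pi.smul_apply, smul_eq_mul]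
  ring

theorem transpose_mul_spinFlip_mul_apply {n : Type*} (w : Matrix (Fin 2 × Fin 2) n ℂ) (k : n) :
    (wᵀ * spinFlip * w) k k = overlap (w.col k) := by
  rw [Matrix.mul_assoc, Matrix.mul_apply]
  rfl

section PureState

variable (ψ : EuclideanSpace ℂ (Fin 2 × Fin 2))

theorem partialTraceB_ketBra_eq :
    partialTraceB (ketBra ψ)
      = Matrix.of (fun i k => ψ (i, k)) * (Matrix.of fun i k => ψ (i, k))ᴴ := by
  ext i j
  simp [partialTraceB, ketBra, Matrix.mul_apply]

theorem posSemidef_partialTraceB_ketBra : (partialTraceB (ketBra ψ)).PosSemidef := by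
  rw [partialTraceB_ketBra_eq]
  exact Matrix.posSemidef_self_mul_conjTranspose _

/-- The reduced state is `A Aᴴ` for the 2×2 coefficient matrix `A` of `ψ`, and `overlap ψ = -2 det
A`. -/
theorem det_partialTraceB_ketBra :
    (partialTraceB (ketBra ψ)).det = ((‖overlap ψ‖ ^ 2 / 4 : ℝ) : ℂ) := by
  have h1 : (Matrix.of fun i k => ψ (i, k) : Matrix (Fin 2) (Fin 2) ℂ).det = -overlap ψ / 2 := by
    rw [Matrix.det_fin_two, overlap_eq]
    simp only [Matrix.of_apply]
    ring
  rw [partialTraceB_ketBra_eq, Matrix.det_mul, Matrix.det_conjTranspose, h1, RCLike.star_def,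
    Complex.mul_conj']
  rw [norm_div, norm_neg]
  push_cast
  norm_num
  ring

variable {ψ}

theorem trace_partialTraceB_ketBra (hψ : ‖ψ‖ = 1) : (partialTraceB (ketBra ψ)).trace = 1 := by
  have h : ∑ i, ‖ψ i‖ ^ 2 = 1 := by
    rw [← EuclideanSpace.norm_sq_eq, hψ, one_pow]
  have h2 : (partialTraceB (ketBra ψ)).trace = ((∑ i, ‖ψ i‖ ^ 2 : ℝ) : ℂ) := by
    rw [Fintype.sum_prod_type]
    push_cast
    simp only [Matrix.trace, Matrix.diag, partialTraceB, ketBra, Matrix.of_apply]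
    refine Finset.sum_congr rfl fun i _ => Finset.sum_congr rfl fun k _ => ?_
    rw [RCLike.star_def, Complex.mul_conj']
  rw [h2, h, Complex.ofReal_one]

theorem pureConcurrence_eq_norm_overlap (hψ : ‖ψ‖ = 1) : pureConcurrence ψ = ‖overlap ψ‖ := by
  have h1 := trace_partialTraceB_ketBra hψ
  have h2 := det_partialTraceB_ketBra ψ
  have h3 : (partialTraceB (ketBra ψ) ^ 2).trace = ((1 - ‖overlap ψ‖ ^ 2 / 2 : ℝ) : ℂ) := by
    rw [Matrix.trace_fin_two] at h1
    rw [Matrix.det_fin_two] at h2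
    rw [sq, Matrix.trace_fin_two, Matrix.mul_apply, Matrix.mul_apply, Fin.sum_univ_two,
      Fin.sum_univ_two]
    push_cast at h2 ⊢
    -- This is `Tr R² = (Tr R)² - 2 det R` for 2×2 matrices, with `Tr R = 1`.
    linear_combination (partialTraceB (ketBra ψ) 0 0 + partialTraceB (ketBra ψ) 1 1 + 1) * h1
      - 2 * h2
  rw [pureConcurrence, h3, Complex.ofReal_re]
  rw [show 2 * (1 - (1 - ‖overlap ψ‖ ^ 2 / 2)) = ‖overlap ψ‖ ^ 2 by ring,
    Real.sqrt_sq (norm_nonneg _)]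

theorem exists_eigenvalues_partialTraceB (hψ : ‖ψ‖ = 1) :
    ∃ a b : ℝ, a + b = 1 ∧ a * b = ‖overlap ψ‖ ^ 2 / 4 ∧
      totalEntropy (partialTraceB (ketBra ψ))
        = (Real.binEntropy a + Real.binEntropy b) / Real.log 2 := by
  have hR := (posSemidef_partialTraceB_ketBra ψ).isHermitian
  refine ⟨hR.eigenvalues 0, hR.eigenvalues 1, ?_, ?_, ?_⟩
  · have := hR.trace_eq_sum_eigenvalues
    rw [trace_partialTraceB_ketBra hψ, Fin.sum_univ_two] at this
    simp only [Complex.coe_algebraMap] at this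
    exact_mod_cast this.symm
  · have := hR.det_eq_prod_eigenvalues
    rw [det_partialTraceB_ketBra, Fin.prod_univ_two] at this
    exact (Complex.ofReal_injective (this.trans (Complex.ofReal_mul _ _).symm)).symm
  · rw [totalEntropy_eq_sum hR, Fin.sum_univ_two]

theorem norm_overlap_le_one (hψ : ‖ψ‖ = 1) : ‖overlap ψ‖ ≤ 1 := by
  obtain ⟨a, b, h1, h2, -⟩ := exists_eigenvalues_partialTraceB hψ
  have hb : b = 1 - a := by linarith
  subst hb
  exact (sq_le_one_iff₀ (norm_nonneg _)).1 (by nlinarith [sq_nonneg (2 * a - 1)])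

theorem normFactor_two : normFactor 2 = 2 := by
  rw [normFactor]
  norm_num

theorem pureEntanglement_eq_h (hψ : ‖ψ‖ = 1) : pureEntanglement ψ = h (pureConcurrence ψ) := by
  obtain ⟨a, b, h1, h2, h3⟩ := exists_eigenvalues_partialTraceB hψ
  have hb : b = 1 - a := by linarith
  subst hb
  rw [pureEntanglement, h3, Fintype.card_fin, normFactor_two, pureConcurrence_eq_norm_overlap hψ,
    h_eq_binEntropy, Real.binEntropy_one_sub]
  -- From `C² = 4a(1 - a)`. Hence `(1 + √(1 - C²)) / 2` is `a` or `1 - a`, and binary entropy does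
  -- not distinguish them.
  have h4 : 1 - ‖overlap ψ‖ ^ 2 = (1 - 2 * a) ^ 2 := by linarith
  have h5 : Real.binEntropy ((1 + |1 - 2 * a|) / 2) = Real.binEntropy a := by
    rcases abs_cases (1 - 2 * a) with ⟨h, -⟩ | ⟨h, -⟩
    · rw [h, ← Real.binEntropy_one_sub a]
      congr 1
      ring
    · rw [h]
      congr 1
      ring
  rw [h4, Real.sqrt_sq_eq_abs, h5]
  ring

end PureState

/-! ### Decompositions as factorizations `ρ = w wᴴ`. -/

section Decomposition

variable {ι : Type*} [Fintype ι] {ρ : Matrix ι ι ℂ}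

theorem convexRoof_eq_of_forall_le {f : EuclideanSpace ℂ ι → ℝ} {v : ℝ}
    (hle : ∀ D : PureDecomposition ρ, v ≤ ∑ i, D.p i * f (D.state i))
    (hex : ∃ D : PureDecomposition ρ, ∑ i, D.p i * f (D.state i) = v) :
    convexRoof f ρ = v := by
  obtain ⟨D, hD⟩ := hex
  have : IsLeast (Set.range fun D : PureDecomposition ρ => ∑ i, D.p i * f (D.state i)) v :=
    ⟨⟨D, hD⟩, by rintro _ ⟨D', rfl⟩; exact hle D'⟩
  exact this.csInf_eq

/-- The matrix whose columns are the states of a decomposition, weighted by the square roots of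
the probabilities. -/
noncomputable def PureDecomposition.toMatrix (D : PureDecomposition ρ) : Matrix ι (Fin D.n) ℂ :=
  Matrix.of fun i j => (√(D.p j) : ℂ) * D.state j i

theorem PureDecomposition.toMatrix_mul_conjTranspose (D : PureDecomposition ρ) :
    D.toMatrix * D.toMatrixᴴ = ρ := by
  conv_rhs => rw [D.decomp]
  ext i j
  rw [Matrix.mul_apply, Matrix.sum_apply]
  refine Finset.sum_congr rfl fun k _ => ?_
  have h1 : (√(D.p k) : ℂ) * (√(D.p k) : ℂ) = D.p k := by
    rw [← Complex.ofReal_mul, Real.mul_self_sqrt (D.p_nonneg k)]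
  simp only [toMatrix, Matrix.conjTranspose_apply, Matrix.of_apply, Matrix.smul_apply, ketBra,
    smul_eq_mul, star_mul', RCLike.star_def, Complex.conj_ofReal]
  linear_combination (D.state k i * (starRingEnd ℂ) (D.state k j)) * h1

/-- The columns of a factorization `ρ = w wᴴ` of a state, normalized, decompose the state. -/
theorem exists_pureDecomposition [Nonempty ι] {n : ℕ} {w : Matrix ι (Fin n) ℂ}
    (hw : w * wᴴ = ρ) (htr : ρ.trace = 1) :
    ∃ D : PureDecomposition ρ, ∀ k : Fin D.n, D.p k = 0 ∨
      ∃ j : Fin n, D.p k = ((wᴴ * w) j j).re ∧ D.p k ≠ 0 ∧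
        (D.state k).ofLp = ((√(D.p k))⁻¹ : ℂ) • w.col j := by
  classical
  let v : Fin n → EuclideanSpace ℂ ι := fun j => WithLp.toLp 2 (w.col j)
  have hv : ∀ j, (wᴴ * w) j j = ((‖v j‖ ^ 2 : ℝ) : ℂ) := fun j => by
    rw [EuclideanSpace.norm_sq_eq, Matrix.mul_apply]
    push_cast
    refine Finset.sum_congr rfl fun i _ => ?_
    rw [← Complex.conj_mul']
    rfl
  let e : EuclideanSpace ℂ ι := EuclideanSpace.single (Classical.arbitrary ι) 1
  let D : PureDecomposition ρ :=
    { n := n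
      p := fun j => ‖v j‖ ^ 2
      -- A zero column has weight zero and still needs a unit vector, so an arbitrary `e` is
      -- inserted; hence the alternative `D.p k = 0` in the conclusion.
      state := fun j => if v j = 0 then e else ((‖v j‖⁻¹ : ℝ) : ℂ) • v j
      p_nonneg := fun j => sq_nonneg _
      p_sum := by
        have h1 : (wᴴ * w).trace = 1 := by rw [Matrix.trace_mul_comm, hw, htr]
        have h2 : ∑ j, ((‖v j‖ ^ 2 : ℝ) : ℂ) = 1 :=
          (Finset.sum_congr rfl fun j _ => (hv j).symm).trans h1
        exact_mod_cast h2
      state_norm := fun j => by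
        by_cases h : v j = 0
        · simp [h, e]
        · have : ‖v j‖ ≠ 0 := norm_ne_zero_iff.2 h
          simp [h, norm_smul, this]
      decomp := by
        rw [← hw]
        ext i k
        rw [Matrix.mul_apply, Matrix.sum_apply]
        refine Finset.sum_congr rfl fun j _ => ?_
        by_cases h : v j = 0
        · have h1 : w i j = 0 := congrFun (congrArg WithLp.ofLp h) i
          simp [h, h1]
        · have h0 : (‖v j‖ : ℂ) ≠ 0 := by exact_mod_cast norm_ne_zero_iff.2 h
          simp only [h, if_false, Matrix.smul_apply, ketBra, Matrix.of_apply, PiLp.smul_apply,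
            smul_eq_mul, star_mul', RCLike.star_def, Complex.conj_ofReal,
            Matrix.conjTranspose_apply]
          push_cast
          field_simp
          rfl }
  refine ⟨D, fun k => ?_⟩
  by_cases h : v k = 0
  · left
    simp [D, h]
  · right
    have h0 : ‖v k‖ ≠ 0 := norm_ne_zero_iff.2 h
    refine ⟨k, ?_, pow_ne_zero 2 h0, ?_⟩
    · rw [hv, Complex.ofReal_re]
    · simp only [D, h, if_false, Real.sqrt_sq (norm_nonneg _)]
      push_cast
      rfl

end Decomposition

/-! ### Evaluation of the two convex roofs. -/

theorem woottersConcurrence_le {ρ : Matrix (Fin 2 × Fin 2) (Fin 2 × Fin 2) ℂ}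
    (hρ : IsState ρ) (D : PureDecomposition ρ) :
    woottersConcurrence ρ ≤ ∑ i, D.p i * pureConcurrence (D.state i) := by
  obtain ⟨V, l, rfl, hl, hl', hV⟩ := exists_spinFlip_diagonal hρ.1
  rw [woottersConcurrence_eq hl hl' hV]
  refine max_le (Finset.sum_nonneg fun i _ => mul_nonneg (D.p_nonneg i) (Real.sqrt_nonneg _)) ?_
  refine (sub_le_sum_norm_of_mul_conjTranspose_eq hl hV D.toMatrix_mul_conjTranspose).trans
    (le_of_eq (Finset.sum_congr rfl fun j _ => ?_))
  have h1 : D.toMatrix.col j = (√(D.p j) : ℂ) • (D.state j).ofLp := rfl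
  rw [transpose_mul_spinFlip_mul_apply, h1, overlap_smul, norm_mul, norm_pow, Complex.norm_real,
    Real.norm_of_nonneg (Real.sqrt_nonneg _), Real.sq_sqrt (D.p_nonneg j),
    pureConcurrence_eq_norm_overlap (D.state_norm j)]

/-- Wootters' optimal decomposition, all of whose members have the same concurrence. -/
theorem exists_pureDecomposition_forall_pureConcurrence_eq
    {ρ : Matrix (Fin 2 × Fin 2) (Fin 2 × Fin 2) ℂ} (hρ : IsState ρ) :
    ∃ D : PureDecomposition ρ, ∀ k, D.p k = 0 ∨
      pureConcurrence (D.state k) = woottersConcurrence ρ := by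
  obtain ⟨V, l, rfl, hl, hl', hV⟩ := exists_spinFlip_diagonal hρ.1
  rw [woottersConcurrence_eq hl hl' hV]
  set W := max 0 (l 0 - l 1 - l 2 - l 3) with hW
  obtain ⟨w, hw, h⟩ : ∃ w : Matrix (Fin 2 × Fin 2) (Fin 4) ℂ, w * wᴴ = V * Vᴴ ∧
      ∀ k, (wᵀ * spinFlip * w) k k = (W : ℂ) * (wᴴ * w) k k := by
    -- If the difference is nonpositive, the polygon with sides `l i` closes and all overlaps can
    -- vanish; otherwise they are made proportional to the weights.
    rcases le_total (l 0 - l 1 - l 2 - l 3) 0 with h0 | h0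
    · obtain ⟨w, hw, h⟩ := exists_overlap_eq_zero hl hl' hV (by linarith)
      refine ⟨w, hw, fun k => ?_⟩
      rw [h, hW, max_eq_left h0, Complex.ofReal_zero, zero_mul]
    · obtain ⟨w, hw, h⟩ := exists_overlap_eq_mul hV hρ.2
      refine ⟨w, hw, fun k => ?_⟩
      rw [h, hW, max_eq_right h0]
  obtain ⟨D, hD⟩ := exists_pureDecomposition hw hρ.2
  refine ⟨D, fun k => (hD k).imp_right ?_⟩
  rintro ⟨j, hp, hp0, hs⟩
  have him : (wᴴ * w) j j = ((D.p k : ℝ) : ℂ) := by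
    rw [hp]
    exact (Complex.conj_eq_iff_re.1
      ((Matrix.isHermitian_conjTranspose_mul_self w).apply j j)).symm
  have h1 := h j
  rw [transpose_mul_spinFlip_mul_apply, him] at h1
  have h2 : (D.p k : ℂ) ≠ 0 := by exact_mod_cast hp0
  have h3 : ((√(D.p k))⁻¹ : ℂ) ^ 2 = (D.p k : ℂ)⁻¹ := by
    rw [inv_pow, ← Complex.ofReal_pow, Real.sq_sqrt (D.p_nonneg k)]
  rw [pureConcurrence_eq_norm_overlap (D.state_norm k), hs, overlap_smul, h1, h3,
    mul_left_comm, inv_mul_cancel₀ h2, mul_one, Complex.norm_real,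
    Real.norm_of_nonneg (le_max_left _ _)]

theorem concurrence_eq_woottersConcurrence
    {ρ : Matrix (Fin 2 × Fin 2) (Fin 2 × Fin 2) ℂ} (hρ : IsState ρ) :
    concurrence ρ = woottersConcurrence ρ := by
  refine convexRoof_eq_of_forall_le (woottersConcurrence_le hρ) ?_
  obtain ⟨D, hD⟩ := exists_pureDecomposition_forall_pureConcurrence_eq hρ
  refine ⟨D, ?_⟩
  rw [← one_mul (woottersConcurrence ρ), ← D.p_sum, Finset.sum_mul]
  refine Finset.sum_congr rfl fun k _ => ?_
  rcases hD k with h | h <;> rw [h]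
  simp

theorem entanglement_eq_h_woottersConcurrence
    {ρ : Matrix (Fin 2 × Fin 2) (Fin 2 × Fin 2) ℂ} (hρ : IsState ρ) :
    entanglement ρ = h (woottersConcurrence ρ) := by
  refine convexRoof_eq_of_forall_le (fun D => ?_) ?_
  · have hmem : ∀ i, pureConcurrence (D.state i) ∈ Set.Icc (0 : ℝ) 1 := fun i =>
      ⟨Real.sqrt_nonneg _, by
        rw [pureConcurrence_eq_norm_overlap (D.state_norm i)]
        exact norm_overlap_le_one (D.state_norm i)⟩
    have hle := woottersConcurrence_le hρ D
    have hsum : ∑ i, D.p i * pureConcurrence (D.state i) ∈ Set.Icc (0 : ℝ) 1 :=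
      (convex_Icc (0 : ℝ) 1).sum_mem (fun i _ => D.p_nonneg i) D.p_sum (fun i _ => hmem i)
    have h0 : 0 ≤ woottersConcurrence ρ := le_max_left _ _
    -- Monotonicity applies to the lower bound on the average concurrence, then Jensen's inequality
    -- moves `h` inside the average.
    calc h (woottersConcurrence ρ) ≤ h (∑ i, D.p i * pureConcurrence (D.state i)) :=
          monotoneOn_h ⟨h0, hle.trans hsum.2⟩ hsum hle
      _ ≤ ∑ i, D.p i * h (pureConcurrence (D.state i)) :=
          convexOn_h.map_sum_le (fun i _ => D.p_nonneg i) D.p_sum (fun i _ => hmem i)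
      _ = ∑ i, D.p i * pureEntanglement (D.state i) :=
          Finset.sum_congr rfl fun i _ => by rw [pureEntanglement_eq_h (D.state_norm i)]
  · obtain ⟨D, hD⟩ := exists_pureDecomposition_forall_pureConcurrence_eq hρ
    refine ⟨D, ?_⟩
    rw [← one_mul (h (woottersConcurrence ρ)), ← D.p_sum, Finset.sum_mul]
    refine Finset.sum_congr rfl fun k _ => ?_
    rw [pureEntanglement_eq_h (D.state_norm k)]
    rcases hD k with h | h <;> rw [h]
    simp

end TotalEntropy

theorem mainTheorem2 (ρ : Matrix (Fin 2 × Fin 2) (Fin 2 × Fin 2) ℂ)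
    (hρ : TotalEntropy.IsState ρ) :
    TotalEntropy.entanglement ρ = TotalEntropy.h (TotalEntropy.concurrence ρ) ∧
      TotalEntropy.concurrence ρ = TotalEntropy.woottersConcurrence ρ := by
  have hc := TotalEntropy.concurrence_eq_woottersConcurrence hρ
  exact ⟨by rw [hc, TotalEntropy.entanglement_eq_h_woottersConcurrence hρ], hc⟩
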